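/- **Setting.** $\|\cdot\|$ is the sup norm on $\mathbb R^n$. Let $\mathcal X\subseteq\mathbb R^n$, $f,c_1,\dots,c_m:\mathcal X\to\mathbb R$ ($m\ge1$), $h(x)=\sum_{j=1}^m\max\{c_j(x),0\}$ on $\mathcal X$, and $\mathcal D=\{x\in\mathcal X: c_j(x)\le 0\ \forall j\}=\{x\in\mathcal X:h(x)=0\}$. Assume that $f$ and $h$ are locally Lipschitz on $\mathcal X$, the $c_j$ are continuous on $\mathcal X$, and $f$ is bounded below on $\mathcal X$. **Algorithm (StoMADS-PB).** Fix $x^0\in\mathcal X$, $\tau\in(0,1)$, $\varepsilon>0$, $\gamma>2$, an integer $\hat z\ge1$, $0<\delta_p^0\le\tau^{-\hat z}$, and a matrix $\mathbf D\in\mathbb R^{n\times p}$ whose columns form a positive spanning set; let $b$ be the largest norm of a column. Put $x^0_{\rm inf}=x^0_{\rm feas}=x^0$ and $\mathrm{flag}=$ false. At iteration $k=0,1,2,\dots$ let $\delta_m^k=\min\{\delta_p^k,(\delta_p^k)^2\}$, and let $\mathcal V^k=\{x^k_{\rm inf},x^k_{\rm feas}\}$ if flag is true and $\mathcal V^k=\{x^k_{\rm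 inf}\}$ otherwise. Around each $x\in\mathcal V^k$ there is a finite positive spanning set $\mathbb D_p^k(x)$ of nonzero polling directions $d$ with $\delta_m^k\|d\|\le b\,\delta_p^k$ such that $x+\delta_m^kd$ lies on the mesh $\{y+\delta_m^k\mathbf Dz:y\in\mathcal V^k,z\in\mathbb Z^p\}$. The poll set is $\mathcal P^k=\bigcup_{x\in\mathcal V^k}\{x+\delta_m^kd\in\mathcal X:d\in\mathbb D^k_p(x)\}$. Real-valued estimates $f_0^k,c^k_{j,0}$ of $f,c_j$ at $x_{\rm inf}^k,x_{\rm feas}^k$, and $f_s^k,c^k_{j,s}$ at the points of $\mathcal P^k$, are available; for $\bullet\in\{0,s\}$ let $h^k_\bullet=\sum_j\max\{c^k_{j,\bullet},0\}$, $\ell^k_\bullet=\sum_j\max\{c^k_{j,\bullet}-\varepsilon(\delta_p^k)^2,0\}$, $u^k_\bullet=\sum_j\max\{c^k_{j,\bullet}+\varepsilon(\delta_p^k)^2,0\}$. * *$f$-Dominating*: some $y\in\mathcal P^k$ has $u_s^k(y)=0$ and, if flag is true, also $f_s^k(y)-f_0^k(x^k_{\rm feas})\le-\gamma\varepsilon(\delta_p^k)^2$.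 Then $x_{\rm feas}^{k+1}=y$ for such a $y$, $x_{\rm inf}^{k+1}=x_{\rm inf}^k$, $\delta_p^{k+1}=\min\{\tau^{-1}\delta_p^k,\tau^{-\hat z}\}$, and flag becomes true. * Otherwise, *$h$-Dominating*: some $y\in\mathcal P^k$ polled from $x_{\rm inf}^k$ has $f_s^k(y)-f_0^k(x_{\rm inf}^k)\le-\gamma\varepsilon(\delta_p^k)^2$, $h_s^k(y)-h_0^k(x_{\rm inf}^k)\le-\gamma m\varepsilon(\delta_p^k)^2$ and $0<u_s^k(y)\le u_0^k(x_{\rm inf}^k)$. Then $x_{\rm inf}^{k+1}=y$ for such a $y$, $x_{\rm feas}^{k+1}=x_{\rm feas}^k$, and $\delta_p^{k+1}$ is as above. * Otherwise, *Improving*: some $y\in\mathcal P^k$ polled from $x_{\rm inf}^k$ has $h_s^k(y)-h_0^k(x_{\rm inf}^k)\le-\gamma m\varepsilon(\delta_p^k)^2$. Then $x_{\rm inf}^{k+1}$ is one of these $y$ with least $u_s^k(y)$, $x_{\rm feas}^{k+1}=x_{\rm feas}^k$, and $\delta_p^{k+1}$ is as above. * Otherwise, *Unsuccessful*: the incumbents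 do not change and $\delta_p^{k+1}=\tau\delta_p^k$. The estimates are random variables on a probability space, so that all quantities are random; capital letters denote them. Let $\mathcal F_{k-1}$ be the $\sigma$-algebra generated by all estimates of iterations $0,\dots,k-1$ ($\mathcal F_{-1}$ is trivial); $X^k_{\rm inf}$, $X^k_{\rm feas}$, $\Delta_p^k$ and flag at the start of iteration $k$ are $\mathcal F_{k-1}$-measurable. **Assumptions.** All realizations of $X^k_{\rm inf},X^k_{\rm feas}$ lie in one compact set $\mathcal U\subseteq\mathcal X$. There is $d_{\min}>0$ with $\delta_p^k\|d\|\ge d_{\min}$ for all $k$ and all polling directions $d$. The numbers $\alpha,\beta,\nu\in(0,1)$ satisfy $$\frac{\nu}{1-\nu}\ge\frac{2(\tau^{-2}-1)}{\gamma-2},\qquad \alpha\beta\ge\frac{4\nu}{(1-\nu)(1-\tau^2)}\left[(1-\alpha)^{1/2}+2(1-\beta)^{1/2}\right],\qquad \alpha\beta\in(1/2,1).$$ For all $k$, almost surely, with $X^k$ ranging over $X_{\rm inf}^k,X_{\rm feas}^k$ and $Y$ over the points of $\mathcal P^k$ (a maximum over an empty poll set being $0$), and with all the variables whose conditional expectation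 is taken integrable: 1. conditionally on $\mathcal F_{k-1}$, with probability at least $\beta$ all the errors $|F_0^k-f(X^k)|$, $|F_s^k-f(Y)|$ are at most $\varepsilon(\Delta_p^k)^2$; 2. $\mathbb E[|F_0^k-f(X^k)|^2\mid\mathcal F_{k-1}]$ for each $X^k$, and $\mathbb E[\max_Y|F_s^k-f(Y)|^2\mid\mathcal F_{k-1}]$, are at most $\varepsilon^2(1-\sqrt\beta)(\Delta_p^k)^4$; 3. for each $j$, conditionally on $\mathcal F_{k-1}$, with probability at least $\alpha^{1/m}$ all the errors $|C_{j,0}^k-c_j(X^k)|$, $|C_{j,s}^k-c_j(Y)|$ are at most $\varepsilon(\Delta_p^k)^2$; 4. for each $j$, $\mathbb E[|C_{j,0}^k-c_j(X^k)|^2\mid\mathcal F_{k-1}]$ for each $X^k$, and $\mathbb E[\max_Y|C_{j,s}^k-c_j(Y)|^2\mid\mathcal F_{k-1}]$, are at most $\varepsilon^2(1-\alpha^{1/(2m)})(\Delta_p^k)^4$; 5. conditionally on $\mathcal F_{k-1}$, with probability at least $\alpha$ all the inequalities $L_0^k\le h(X^k)\le U_0^k$ and $L_s^k\le h(Y)\le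 U_s^k$ hold; 6. $\mathbb E[|H_0^k-h(X^k)|\mid\mathcal F_{k-1}]$ for each $X^k$, and $\mathbb E[\max_Y|H_s^k-h(Y)|\mid\mathcal F_{k-1}]$, are at most $m\varepsilon(1-\alpha)^{1/2}(\Delta_p^k)^2$. Finally $T:=\inf\{k\ge0: X_{\rm feas}^\ell\ne x^0\text{ for some }\ell\le k\}<\infty$ almost surely. Write $k\vee T=\max\{k,T\}$ and, for a polling direction $d$ around $X_{\rm feas}^{k\vee T}$ at iteration $k$ leading to a point of $\mathcal X$, $$\Psi_k^{f,T}(d)=\frac{f(X_{\rm feas}^{k\vee T})-f(X_{\rm feas}^{k\vee T}+\Delta_m^kd)}{\Delta_p^k}.$$ **Definitions.** For $O\subseteq\mathbb R^n$, the hypertangent cone $T^H_O(\hat x)$ is the set of $v$ for which there is $r>0$ with $y+tw\in O$ whenever $y\in O$, $\|y-\hat x\|<r$, $\|w-v\|<r$, $0<t<r$. Also $$f^\circ(\hat x;v)=\limsup_{\substack{y\to\hat x,\ y\in\mathcal X\\ t\searrow0,\ y+tv\in\mathcal X}}\frac{f(y+tv)-f(y)}t .$$ For an infinite $\mathcal K\subseteq\mathbb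 N$, $v$ is a refining direction if there are an infinite $\mathcal L\subseteq\mathcal K$ and polling directions $d^k$ ($k\in\mathcal L$) around $x_{\rm feas}^{k\vee t}$ at iteration $k$ with $v=\lim_{k\in\mathcal L}d^k/\|d^k\|$. For an outcome with $T=t<\infty$, call $(\mathcal K,\hat x)$ *good* if $\mathcal K$ is infinite and along $\mathcal K$: $x_{\rm feas}^{k\vee t}\to\hat x$, $\delta_m^k\to0$, $\limsup\psi_k^{f,t}\le0$ (uniformly over the polling directions $d$ as above), and $h_0^k(x_{\rm feas}^{k\vee t})\to0$. **Theorem.** Let the random index set $K$ and the random point $\hat X_{\rm feas}$ be such that $(K,\hat X_{\rm feas})$ is good almost surely. Then: (i) $\hat X_{\rm feas}\in\mathcal D$ almost surely. (ii) For every outcome with $T=t<\infty$, with $\delta_p^k\to0$, and for which $(\mathcal K,\hat x_{\rm feas})$ (the realization of $(K,\hat X_{\rm feas})$) is good and $\hat x_{\rm feas}\in\mathcal D$: $f^\circ(\hat x_{\rm feas};v)\ge0$ for every refining direction $v\in T^H_{\mathcal D}(\hat x_{\rm feas})$ such that either $v\in T^H_{\mathcal X}(\hat x_{\rm feas})$ (automatic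 if $\hat x_{\rm feas}$ is interior to $\mathcal X$ or $\mathcal X$ is convex), or $x_{\rm feas}^{k\vee t}\in\mathcal D$ for all large $k\in\mathcal K$. (iii) In particular, with probability one, $\hat X_{\rm feas}\in\mathcal D$ and $f^\circ(\hat X_{\rm feas};v)\ge0$ for all $v$ as in (ii). -/

import Mathlib

open MeasureTheory Filter Topology
open scoped ProbabilityTheory NNReal

namespace StoMADS

/-- Points and directions of `ℝⁿ`; the norm of this type is the sup norm `‖·‖_∞`. -/
abbrev Pt (n : ℕ) : Type := Fin n → ℝ

/-! ### The problem  `min f(x)` subject to `x ∈ X`, `c(x) ≤ 0` -/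

/-- The functions `f` and `c j` are only ever used at points of `X`. -/
structure Problem (n m : ℕ) where
  X : Set (Pt n)
  f : Pt n → ℝ
  c : Fin m → Pt n → ℝ

/-- The constraint violation function `h` (on `X`). -/
def Problem.h {n m : ℕ} (P : Problem n m) (x : Pt n) : ℝ := ∑ j, max (P.c j x) 0

/-- The feasible region. -/
def Problem.feasible {n m : ℕ} (P : Problem n m) : Set (Pt n) :=
  {x | x ∈ P.X ∧ ∀ j, P.c j x ≤ 0}

/-- `f` and `h` are locally Lipschitz on `X`, the constraints are continuous on `X`, and `f` is
bounded from below. -/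
structure Problem.Regular {n m : ℕ} (P : Problem n m) : Prop where
  lipschitz_f : LocallyLipschitzOn P.X P.f
  lipschitz_h : LocallyLipschitzOn P.X P.h
  continuous_c : ∀ j, ContinuousOn (P.c j) P.X
  bounded_f : ∃ κ : ℝ, ∀ x ∈ P.X, κ ≤ P.f x

/-! ### Nonsmooth analysis -/

/-- The hypertangent cone to `O` at `x`. -/
def hypertangentCone {n : ℕ} (O : Set (Pt n)) (x : Pt n) : Set (Pt n) :=
  {v | ∃ r > 0, ∀ y ∈ O ∩ Metric.ball x r, ∀ w ∈ Metric.ball v r, ∀ t : ℝ,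
    0 < t → t < r → y + t • w ∈ O}

/-- The Clarke generalized derivative at `x` in the direction `v` of a function defined on `X`:
upper limit of `(f (y + t v) - f y) / t` as `y → x`, `t ↘ 0` with `y ∈ X` and `y + t v ∈ X`. -/
noncomputable def clarkeDeriv {n : ℕ} (X : Set (Pt n)) (f : Pt n → ℝ) (x v : Pt n) : EReal :=
  limsup (fun q : Pt n × ℝ => (((f (q.1 + q.2 • v) - f q.1) / q.2 : ℝ) : EReal))
    ((𝓝 x ×ˢ 𝓝[>] (0 : ℝ)) ⊓ 𝓟 {q | q.1 ∈ X ∧ q.1 + q.2 • v ∈ X})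

/-- Every vector is a linear combination of elements of `S` with nonnegative coefficients. -/
def PositiveSpanning {n : ℕ} (S : Set (Pt n)) : Prop := Submodule.span ℝ≥0 S = ⊤

/-! ### The algorithm -/

/-- Constants of the algorithm: the matrix `D` defining the mesh, the initial point, the initial
poll size, and `τ`, `ε`, `γ`, `zhat`. -/
structure Params (n : ℕ) where
  p : ℕ
  D : Matrix (Fin n) (Fin p) ℝ
  x0 : Pt n
  δ0 : ℝ
  τ : ℝ
  ε : ℝ
  γ : ℝ
  zhat : ℕ

structure Params.Valid {n m : ℕ} (A : Params n) (P : Problem n m) : Prop where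
  spanning : PositiveSpanning (Set.range fun i r => A.D r i)
  x0_mem : A.x0 ∈ P.X
  δ0_pos : 0 < A.δ0
  δ0_le : A.δ0 ≤ (A.τ ^ A.zhat)⁻¹
  τ_pos : 0 < A.τ
  τ_lt : A.τ < 1
  ε_pos : 0 < A.ε
  γ_gt : 2 < A.γ
  zhat_pos : 0 < A.zhat

/-- `b = max ‖d'‖` over the columns `d'` of `D`. -/
noncomputable def Params.b {n : ℕ} (A : Params n) : ℝ := ⨆ i, ‖fun r => A.D r i‖

/-- The two kinds of incumbents (poll centers): `ε`-infeasible and `ε`-feasible. -/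
inductive Center : Type
  | inf : Center
  | feas : Center

/-- The random quantities of the algorithm at iteration `k` and outcome `ω`.
* `inc k .inf`, `inc k .feas`: the incumbents; `δ k`: poll size;
  `flag k`: whether an `ε`-feasible point has been found;
* `dir k c i`, `i < num k c`: the list of polling directions around the incumbent `c`;
* `F0 k c`, `C0 k j c`: estimates of `f`, `c_j` at the incumbent `c`;
* `Fs k c i`, `Cs k j c i`: estimates of `f`, `c_j` at the trial point that is generated
  from the incumbent `c` by the `i`-th direction (irrelevant if there is no such trial point). -/
structure AlgRun (n m : ℕ) (Ω : Type*) where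
  inc : ℕ → Center → Ω → Pt n
  δ : ℕ → Ω → ℝ
  flag : ℕ → Ω → Bool
  num : ℕ → Center → Ω → ℕ
  dir : ℕ → Center → ℕ → Ω → Pt n
  F0 : ℕ → Center → Ω → ℝ
  Fs : ℕ → Center → ℕ → Ω → ℝ
  C0 : ℕ → Fin m → Center → Ω → ℝ
  Cs : ℕ → Fin m → Center → ℕ → Ω → ℝ

namespace AlgRun

variable {n m : ℕ} {Ω : Type*}

/-- The mesh size `min {δ, δ²}`. -/
noncomputable def δm (R : AlgRun n m Ω) (k : ℕ) (ω : Ω) : ℝ := min (R.δ k ω) (R.δ k ω ^ 2)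

/-- `Active k ω c`: the incumbent `c` belongs to the set `V^k` of incumbent solutions. -/
def Active (R : AlgRun n m Ω) (k : ℕ) (ω : Ω) : Center → Prop
  | .inf => True
  | .feas => R.flag k ω = true

/-- The mesh `M^k`. -/
def mesh (R : AlgRun n m Ω) (A : Params n) (k : ℕ) (ω : Ω) : Set (Pt n) :=
  {y | ∃ c, R.Active k ω c ∧ ∃ z : Fin A.p → ℤ,
    y = R.inc k c ω + R.δm k ω • A.D.mulVec (fun i => (z i : ℝ))}

/-- The set of polling directions around the incumbent `c` at iteration `k`. -/
def pollDirs (R : AlgRun n m Ω) (k : ℕ) (c : Center) (ω : Ω) : Set (Pt n) :=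
  {d | ∃ i < R.num k c ω, d = R.dir k c i ω}

/-- The polling directions form a positive spanning set of nonzero vectors, lead to mesh points
and stay inside the frame. -/
structure IsFrame (R : AlgRun n m Ω) (A : Params n) (k : ℕ) (c : Center) (ω : Ω) : Prop where
  spanning : PositiveSpanning (R.pollDirs k c ω)
  ne_zero : ∀ d ∈ R.pollDirs k c ω, d ≠ 0
  mem_mesh : ∀ d ∈ R.pollDirs k c ω, R.inc k c ω + R.δm k ω • d ∈ R.mesh A k ω
  norm_le : ∀ d ∈ R.pollDirs k c ω, R.δm k ω * ‖d‖ ≤ R.δ k ω * A.b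

/-- The candidate `x^k + s^k` with `x^k` the incumbent `c` and `s^k = δm d` for the `i`-th
direction. -/
noncomputable def trial (R : AlgRun n m Ω) (k : ℕ) (c : Center) (i : ℕ) (ω : Ω) : Pt n :=
  R.inc k c ω + R.δm k ω • R.dir k c i ω

/-- The candidate belongs to the poll set `P^k`. -/
def InPoll (R : AlgRun n m Ω) (P : Problem n m) (k : ℕ) (ω : Ω) (c : Center) (i : ℕ) : Prop :=
  R.Active k ω c ∧ i < R.num k c ω ∧ R.trial k c i ω ∈ P.X

/-! Estimated violations `h_0`, `h_s` and bounds `ℓ_0`, `u_0`, `ℓ_s`, `u_s`. -/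

noncomputable def H0 (R : AlgRun n m Ω) (k : ℕ) (c : Center) (ω : Ω) : ℝ :=
  ∑ j, max (R.C0 k j c ω) 0

noncomputable def Hs (R : AlgRun n m Ω) (k : ℕ) (c : Center) (i : ℕ) (ω : Ω) : ℝ :=
  ∑ j, max (R.Cs k j c i ω) 0

noncomputable def L0 (R : AlgRun n m Ω) (A : Params n) (k : ℕ) (c : Center) (ω : Ω) : ℝ :=
  ∑ j, max (R.C0 k j c ω - A.ε * R.δ k ω ^ 2) 0

noncomputable def U0 (R : AlgRun n m Ω) (A : Params n) (k : ℕ) (c : Center) (ω : Ω) : ℝ :=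
  ∑ j, max (R.C0 k j c ω + A.ε * R.δ k ω ^ 2) 0

noncomputable def Ls (R : AlgRun n m Ω) (A : Params n) (k : ℕ) (c : Center) (i : ℕ) (ω : Ω) :
    ℝ :=
  ∑ j, max (R.Cs k j c i ω - A.ε * R.δ k ω ^ 2) 0

noncomputable def Us (R : AlgRun n m Ω) (A : Params n) (k : ℕ) (c : Center) (i : ℕ) (ω : Ω) :
    ℝ :=
  ∑ j, max (R.Cs k j c i ω + A.ε * R.δ k ω ^ 2) 0

/-- A candidate that makes the iteration `f`-dominating: it is `ε`-feasible and, if there already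
is an `ε`-feasible incumbent, it dominates that incumbent. -/
def FDom (R : AlgRun n m Ω) (P : Problem n m) (A : Params n) (k : ℕ) (ω : Ω) (c : Center)
    (i : ℕ) : Prop :=
  R.InPoll P k ω c i ∧ R.Us A k c i ω = 0 ∧
    (R.flag k ω = true → R.Fs k c i ω - R.F0 k .feas ω ≤ -(A.γ * A.ε * R.δ k ω ^ 2))

/-- A candidate around the `ε`-infeasible incumbent with a sufficient decrease of the estimated
violation. -/
def Impr (R : AlgRun n m Ω) (P : Problem n m) (A : Params n) (k : ℕ) (ω : Ω) (i : ℕ) : Prop :=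
  R.InPoll P k ω .inf i ∧
    R.Hs k .inf i ω - R.H0 k .inf ω ≤ -(A.γ * m * A.ε * R.δ k ω ^ 2)

/-- A candidate that makes the iteration `h`-dominating: it is `ε`-infeasible, below the barrier
threshold `u_0 (x_inf)`, and dominates the `ε`-infeasible incumbent. -/
def HDom (R : AlgRun n m Ω) (P : Problem n m) (A : Params n) (k : ℕ) (ω : Ω) (i : ℕ) : Prop :=
  R.Impr P A k ω i ∧
    R.Fs k .inf i ω - R.F0 k .inf ω ≤ -(A.γ * A.ε * R.δ k ω ^ 2) ∧
    0 < R.Us A k .inf i ω ∧ R.Us A k .inf i ω ≤ R.U0 A k .inf ω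

/-- The poll size after a successful iteration. -/
noncomputable def enlarged (R : AlgRun n m Ω) (A : Params n) (k : ℕ) (ω : Ω) : ℝ :=
  min (A.τ⁻¹ * R.δ k ω) (A.τ ^ A.zhat)⁻¹

/-- The update of the algorithm from iteration `k` to iteration `k + 1`; the four alternatives are
`f`-dominating, `h`-dominating, improving and unsuccessful iterations. -/
def Step (R : AlgRun n m Ω) (P : Problem n m) (A : Params n) (k : ℕ) (ω : Ω) : Prop :=
  (∃ c i, R.FDom P A k ω c i ∧
    R.inc (k + 1) .inf ω = R.inc k .inf ω ∧ R.inc (k + 1) .feas ω = R.trial k c i ω ∧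
    R.δ (k + 1) ω = R.enlarged A k ω ∧ R.flag (k + 1) ω = true) ∨
  ((¬ ∃ c i, R.FDom P A k ω c i) ∧ ∃ i, R.HDom P A k ω i ∧
    R.inc (k + 1) .inf ω = R.trial k .inf i ω ∧ R.inc (k + 1) .feas ω = R.inc k .feas ω ∧
    R.δ (k + 1) ω = R.enlarged A k ω ∧ R.flag (k + 1) ω = R.flag k ω) ∨
  ((¬ ∃ c i, R.FDom P A k ω c i) ∧ (¬ ∃ i, R.HDom P A k ω i) ∧
    ∃ i, R.Impr P A k ω i ∧
    (∀ i', R.Impr P A k ω i' → R.Us A k .inf i ω ≤ R.Us A k .inf i' ω) ∧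
    R.inc (k + 1) .inf ω = R.trial k .inf i ω ∧ R.inc (k + 1) .feas ω = R.inc k .feas ω ∧
    R.δ (k + 1) ω = R.enlarged A k ω ∧ R.flag (k + 1) ω = R.flag k ω) ∨
  ((¬ ∃ c i, R.FDom P A k ω c i) ∧ (¬ ∃ i, R.HDom P A k ω i) ∧
    (¬ ∃ i, R.Impr P A k ω i) ∧
    R.inc (k + 1) .inf ω = R.inc k .inf ω ∧ R.inc (k + 1) .feas ω = R.inc k .feas ω ∧
    R.δ (k + 1) ω = A.τ * R.δ k ω ∧ R.flag (k + 1) ω = R.flag k ω)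

/-- The `σ`-algebra generated by all estimates of the iterations `0, …, k - 1`, which is the
conditioning at iteration `k` (trivial for `k = 0`, the initial point being deterministic). -/
def past (R : AlgRun n m Ω) (k : ℕ) : MeasurableSpace Ω :=
  ⨆ l : ℕ, ⨆ _ : l < k, ⨆ c : Center,
    MeasurableSpace.comap (R.F0 l c) inferInstance ⊔
    (⨆ i : ℕ, MeasurableSpace.comap (R.Fs l c i) inferInstance) ⊔
    (⨆ j : Fin m, MeasurableSpace.comap (R.C0 l j c) inferInstance) ⊔
    (⨆ j : Fin m, ⨆ i : ℕ, MeasurableSpace.comap (R.Cs l j c i) inferInstance)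

/-- The process is generated by the algorithm: initialization, admissible polling directions,
updates, measurability of the estimates, and the state at the start of iteration `k` is determined
by the estimates of the previous iterations. -/
structure IsGenerated [MeasurableSpace Ω] (R : AlgRun n m Ω) (P : Problem n m) (A : Params n) :
    Prop where
  inc_zero : ∀ c ω, R.inc 0 c ω = A.x0
  δ_zero : ∀ ω, R.δ 0 ω = A.δ0
  flag_zero : ∀ ω, R.flag 0 ω = false
  frame : ∀ k ω c, R.Active k ω c → R.IsFrame A k c ω
  step : ∀ k ω, R.Step P A k ω
  measurable_F0 : ∀ k c, Measurable (R.F0 k c)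
  measurable_Fs : ∀ k c i, Measurable (R.Fs k c i)
  measurable_C0 : ∀ k j c, Measurable (R.C0 k j c)
  measurable_Cs : ∀ k j c i, Measurable (R.Cs k j c i)
  adapted_inc : ∀ k c, Measurable[R.past k] (R.inc k c)
  adapted_δ : ∀ k, Measurable[R.past k] (R.δ k)
  adapted_flag : ∀ k, Measurable[R.past k] (R.flag k)

/-- All realizations of the incumbents lie in a compact subset of `X`. -/
def IteratesInCompact (R : AlgRun n m Ω) (P : Problem n m) : Prop :=
  ∃ U : Set (Pt n), IsCompact U ∧ U ⊆ P.X ∧ ∀ k c ω, R.inc k c ω ∈ U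

/-- `δ_p ‖d‖` is bounded away from zero over all polling directions of all iterations. -/
def DirectionsBoundedBelow (R : AlgRun n m Ω) : Prop :=
  ∃ dmin > 0, ∀ k ω c, R.Active k ω c → ∀ d ∈ R.pollDirs k c ω, dmin ≤ R.δ k ω * ‖d‖

/-! ### Probabilistic assumptions on the estimates -/

/-- The maximum of `g` over the (finitely many) points of the poll set; `0` if it is empty. -/
noncomputable def maxPoll (R : AlgRun n m Ω) (P : Problem n m) (k : ℕ) (ω : Ω)
    (g : Center → ℕ → ℝ) : ℝ :=
  ⨆ q : {q : Center × ℕ // R.InPoll P k ω q.1 q.2}, g q.1.1 q.1.2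

/-- The event `J_k`: the estimates of `f` at the incumbents and at the poll points are
`ε`-accurate. -/
def J (R : AlgRun n m Ω) (P : Problem n m) (A : Params n) (k : ℕ) : Set Ω :=
  {ω | (∀ c, |R.F0 k c ω - P.f (R.inc k c ω)| ≤ A.ε * R.δ k ω ^ 2) ∧
    ∀ c i, R.InPoll P k ω c i →
      |R.Fs k c i ω - P.f (R.trial k c i ω)| ≤ A.ε * R.δ k ω ^ 2}

/-- The event `I_k^j`: the estimates of `c_j` at the incumbents and at the poll points are
`ε`-accurate. -/
def Icon (R : AlgRun n m Ω) (P : Problem n m) (A : Params n) (j : Fin m) (k : ℕ) : Set Ω :=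
  {ω | (∀ c, |R.C0 k j c ω - P.c j (R.inc k c ω)| ≤ A.ε * R.δ k ω ^ 2) ∧
    ∀ c i, R.InPoll P k ω c i →
      |R.Cs k j c i ω - P.c j (R.trial k c i ω)| ≤ A.ε * R.δ k ω ^ 2}

/-- The event `I_k`: the bounds for `h` at the incumbents and at the poll points are
`ε`-reliable. -/
def Ibd (R : AlgRun n m Ω) (P : Problem n m) (A : Params n) (k : ℕ) : Set Ω :=
  {ω | (∀ c, R.L0 A k c ω ≤ P.h (R.inc k c ω) ∧ P.h (R.inc k c ω) ≤ R.U0 A k c ω) ∧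
    ∀ c i, R.InPoll P k ω c i →
      R.Ls A k c i ω ≤ P.h (R.trial k c i ω) ∧ P.h (R.trial k c i ω) ≤ R.Us A k c i ω}

/-- `E [Y | past] ≤ B` almost surely, for an integrable `Y`. -/
def CondMeanLe [MeasurableSpace Ω] (R : AlgRun n m Ω) (μ : Measure Ω) (k : ℕ) (Y B : Ω → ℝ) :
    Prop :=
  Integrable Y μ ∧ μ[Y | R.past k] ≤ᵐ[μ] B

/-- The accuracy, reliability and variance conditions on the random estimates. -/
structure EstimatesOK [MeasurableSpace Ω] (R : AlgRun n m Ω) (μ : Measure Ω) (P : Problem n m)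
    (A : Params n) (α β : ℝ) : Prop where
  f_accurate : ∀ k, ∀ᵐ ω ∂μ, β ≤ (μ⟦R.J P A k | R.past k⟧) ω
  f_var_s : ∀ k, R.CondMeanLe μ k
    (fun ω => R.maxPoll P k ω fun c i => |R.Fs k c i ω - P.f (R.trial k c i ω)| ^ 2)
    (fun ω => A.ε ^ 2 * (1 - √β) * R.δ k ω ^ 4)
  f_var_0 : ∀ k c, R.CondMeanLe μ k
    (fun ω => |R.F0 k c ω - P.f (R.inc k c ω)| ^ 2)
    (fun ω => A.ε ^ 2 * (1 - √β) * R.δ k ω ^ 4)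
  c_accurate : ∀ j k, ∀ᵐ ω ∂μ, α ^ (1 / (m : ℝ)) ≤ (μ⟦R.Icon P A j k | R.past k⟧) ω
  c_var_s : ∀ j k, R.CondMeanLe μ k
    (fun ω => R.maxPoll P k ω fun c i => |R.Cs k j c i ω - P.c j (R.trial k c i ω)| ^ 2)
    (fun ω => A.ε ^ 2 * (1 - α ^ (1 / (2 * m : ℝ))) * R.δ k ω ^ 4)
  c_var_0 : ∀ j k c, R.CondMeanLe μ k
    (fun ω => |R.C0 k j c ω - P.c j (R.inc k c ω)| ^ 2)
    (fun ω => A.ε ^ 2 * (1 - α ^ (1 / (2 * m : ℝ))) * R.δ k ω ^ 4)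
  bounds_reliable : ∀ k, ∀ᵐ ω ∂μ, α ≤ (μ⟦R.Ibd P A k | R.past k⟧) ω
  h_mean_s : ∀ k, R.CondMeanLe μ k
    (fun ω => R.maxPoll P k ω fun c i => |R.Hs k c i ω - P.h (R.trial k c i ω)|)
    (fun ω => m * A.ε * √(1 - α) * R.δ k ω ^ 2)
  h_mean_0 : ∀ k c, R.CondMeanLe μ k
    (fun ω => |R.H0 k c ω - P.h (R.inc k c ω)|)
    (fun ω => m * A.ε * √(1 - α) * R.δ k ω ^ 2)

/-! ### The random time `T` and refining subsequences of `ε`-feasible iterates -/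

/-- `T = inf {k : some x_feas^l with l ≤ k differs from the initial point}`. -/
noncomputable def T (R : AlgRun n m Ω) (ω : Ω) : ℕ∞ :=
  ⨅ (k : ℕ) (_ : ∃ l ≤ k, R.inc l .feas ω ≠ R.inc 0 .inf ω), (k : ℕ∞)

/-- `x_feas^{k ∨ T}` (meaningful when `T` is finite). -/
noncomputable def xfeasT (R : AlgRun n m Ω) (k : ℕ) (ω : Ω) : Pt n :=
  R.inc (max k (R.T ω).toNat) .feas ω

/-- `Ψ_k^{f,T}` for the polling direction `d`. -/
noncomputable def Psi (R : AlgRun n m Ω) (P : Problem n m) (k : ℕ) (ω : Ω) (d : Pt n) : ℝ :=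
  (P.f (R.xfeasT k ω) - P.f (R.xfeasT k ω + R.δm k ω • d)) / R.δ k ω

/-- At the outcome `ω`, `x_feas^{k ∨ T}`, `k ∈ K`, is a refining subsequence with refined point
`x`; the upper limit of `Ψ_k^{f,T}` over `K` is nonpositive, for all polling directions around
`x_feas^{k ∨ T}` leading to points of `X`; and `H_0^k (x_feas^{k ∨ T})` tends to `0` over `K`. -/
structure GoodSubsequence (R : AlgRun n m Ω) (P : Problem n m) (ω : Ω) (K : Set ℕ) (x : Pt n) :
    Prop where
  infinite : K.Infinite
  tendsto_x : Tendsto (fun k => R.xfeasT k ω) (atTop ⊓ 𝓟 K) (𝓝 x)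
  tendsto_δm : Tendsto (fun k => R.δm k ω) (atTop ⊓ 𝓟 K) (𝓝 0)
  limsup_Psi : ∀ η > 0, ∀ᶠ k in atTop ⊓ 𝓟 K, ∀ d ∈ R.pollDirs k .feas ω,
    R.xfeasT k ω + R.δm k ω • d ∈ P.X → R.Psi P k ω d ≤ η
  tendsto_H0 : Tendsto (fun k => R.H0 k .feas ω) (atTop ⊓ 𝓟 K) (𝓝 0)

/-- `v` is a refining direction for the subsequence `x_feas^{k ∨ T}`, `k ∈ K`. -/
def IsRefiningDir (R : AlgRun n m Ω) (ω : Ω) (K : Set ℕ) (v : Pt n) : Prop :=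
  ∃ L ⊆ K, L.Infinite ∧ ∃ d : ℕ → Pt n, (∀ k ∈ L, d k ∈ R.pollDirs k .feas ω) ∧
    Tendsto (fun k => ‖d k‖⁻¹ • d k) (atTop ⊓ 𝓟 L) (𝓝 v)

/-- The stationarity property of `x`: for every refining direction `v` in the hypertangent cone to
the feasible region at `x`, `f°(x; v) ≥ 0`.  Since the `ε`-feasible iterates may violate the true
constraints, `v` has to be hypertangent to `X` as well, unless the iterates are feasible. -/
def Stationary (R : AlgRun n m Ω) (P : Problem n m) (ω : Ω) (K : Set ℕ) (x : Pt n) : Prop :=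
  ∀ v ∈ hypertangentCone P.feasible x, R.IsRefiningDir ω K v →
    (v ∈ hypertangentCone P.X x ∨ ∀ᶠ k in atTop ⊓ 𝓟 K, R.xfeasT k ω ∈ P.feasible) →
    0 ≤ clarkeDeriv P.X P.f x v

end AlgRun

end StoMADS

/-!
The crucial fact is that the squared poll sizes have summable means. It comes from a potential
(`StoMADS.AlgRun.potential`): a weighted sum of `f` at the `ε`-feasible incumbent, of `h` at the
`ε`-infeasible incumbent and of `δ²`, where `f` is replaced by a large constant until an
`ε`-feasible incumbent exists. A successful iteration decreases the *estimate* of `f` or of `h` by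
a multiple `γ` of the accuracy scale, which outweighs the growth of `δ²`; an unsuccessful one
shrinks `δ²`. Hence on every path the potential drops in each iteration by at least
`(1 - ν) (1 - τ²) δ²`, up to the errors of the estimates (`potential_succ_le`). No accuracy event has to be
singled out: the conditional moment bounds alone give that the mean error is at most half of the
mean drop (`integral_errorBound_le`). As the potential is nonnegative, telescoping over the
iterations and integrating yields `∑ E[δ²] < ∞` (`sum_integral_sq_δ_le`).

Two consequences hold almost surely. First, `δ → 0`. Secondly, the mean of the error
`|H₀ - h(x_feas)|` is at most a multiple of `E[δ²]`, so these errors are summable and tend to zero along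
the whole sequence, whatever random subsequence is chosen afterwards; since `H₀ → 0` along it,
continuity of `h` gives `h(x̂) = 0` (`GoodSubsequence.mem_feasible`).

Stationarity is deterministic (`stationary_of_goodSubsequence`). A polling step `δm d` is a step
of length `t = δm ‖d‖` in the direction `d / ‖d‖`. The frame bound gives `t → 0`, and the lower
bound on `δ ‖d‖` gives `t ≥ dmin δ`, so that the bound on `Ψ` makes the difference quotients of
`f` along these steps asymptotically nonnegative. Hypertangency keeps the points inside `X`, also
when `d / ‖d‖` is replaced by its limit `v`, and the Lipschitz property shows that this
replacement does not matter in the limit.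
-/

namespace StoMADS

/-! ### Probability -/

/-- A bound on a conditional mean may be multiplied by a bounded nonnegative weight that is
measurable with respect to the conditioning, and then integrated. -/
theorem integral_mul_le_of_condExp_le {Ω : Type*} {m m0 : MeasurableSpace Ω} (hm : m ≤ m0)
    {μ : Measure Ω} [IsFiniteMeasure μ] {g Y B : Ω → ℝ} (hg : StronglyMeasurable[m] g)
    (hg0 : ∀ ω, 0 ≤ g ω) {C : ℝ} (hgC : ∀ ω, g ω ≤ C) (hY : Integrable Y μ)
    (hYB : μ[Y | m] ≤ᵐ[μ] B) (hB : Integrable (fun ω => g ω * B ω) μ) :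
    Integrable (fun ω => g ω * Y ω) μ ∧ ∫ ω, g ω * Y ω ∂μ ≤ ∫ ω, g ω * B ω ∂μ := by
  have hgC' : ∀ ω, ‖g ω‖ ≤ C := fun ω => by
    rw [Real.norm_of_nonneg (hg0 ω)]; exact hgC ω
  have hgY : Integrable (fun ω => g ω * Y ω) μ :=
    hY.bdd_mul (hg.mono hm).aestronglyMeasurable (ae_of_all _ hgC')
  refine ⟨hgY, ?_⟩
  have hpull : μ[fun ω => g ω * Y ω | m] =ᵐ[μ] fun ω => g ω * (μ[Y | m]) ω :=
    condExp_mul_of_stronglyMeasurable_left hg hgY hY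
  rw [← integral_condExp hm]
  refine integral_mono_ae integrable_condExp hB ?_
  filter_upwards [hpull, hYB] with ω h1 h2
  rw [h1]
  exact mul_le_mul_of_nonneg_left h2 (hg0 ω)

/-- Nonnegative random variables with summable means tend to zero almost surely. -/
theorem ae_tendsto_zero_of_sum_integral_le {Ω : Type*} [MeasurableSpace Ω] {μ : Measure Ω}
    {Y : ℕ → Ω → ℝ} (hY0 : ∀ k ω, 0 ≤ Y k ω) (hY : ∀ k, Integrable (Y k) μ) {C : ℝ}
    (hC : ∀ N, ∑ k ∈ Finset.range N, ∫ ω, Y k ω ∂μ ≤ C) :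
    ∀ᵐ ω ∂μ, Tendsto (fun k => Y k ω) atTop (𝓝 0) := by
  have hmeas : ∀ k, AEMeasurable (fun ω => ENNReal.ofReal (Y k ω)) μ :=
    fun k => (hY k).aemeasurable.ennreal_ofReal
  have hsum : ∑' k, ∫⁻ ω, ENNReal.ofReal (Y k ω) ∂μ ≤ ENNReal.ofReal C := by
    refine ENNReal.tsum_le_of_sum_range_le fun N => ?_
    rw [Finset.sum_congr rfl fun k _ =>
      (ofReal_integral_eq_lintegral_ofReal (hY k) (ae_of_all _ (hY0 k))).symm,
      ← ENNReal.ofReal_sum_of_nonneg fun k _ => integral_nonneg (hY0 k)]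
    exact ENNReal.ofReal_le_ofReal (hC N)
  have hlt : ∀ᵐ ω ∂μ, ∑' k, ENNReal.ofReal (Y k ω) < ⊤ := by
    refine ae_lt_top' (AEMeasurable.tsum hmeas) ?_
    rw [lintegral_tsum hmeas]
    exact (hsum.trans_lt ENNReal.ofReal_lt_top).ne
  filter_upwards [hlt] with ω hω
  have := ENNReal.tendsto_atTop_zero_of_tsum_ne_top hω.ne
  have h2 := (ENNReal.tendsto_toReal ENNReal.zero_ne_top).comp this
  simpa [Function.comp_def, ENNReal.toReal_ofReal (hY0 _ ω)] using h2

/-! ### Elementary properties of the algorithm -/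

theorem Problem.h_nonneg {n m : ℕ} (P : Problem n m) (x : Pt n) : 0 ≤ P.h x :=
  Finset.sum_nonneg fun _ _ => le_max_right _ _

theorem Problem.mem_feasible_of_h_eq_zero {n m : ℕ} {P : Problem n m} {x : Pt n} (hx : x ∈ P.X)
    (h : P.h x = 0) : x ∈ P.feasible := by
  refine ⟨hx, fun j => ?_⟩
  have := (Finset.sum_eq_zero_iff_of_nonneg fun j _ => le_max_right (P.c j x) 0).1 h j
    (Finset.mem_univ j)
  exact (le_max_left _ _).trans this.le

instance : Finite Center :=
  Finite.of_injective (fun c : Center => match c with | .inf => true | .feas => false)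
    (by rintro (_ | _) (_ | _) h <;> simp_all)

namespace AlgRun

variable {n m : ℕ} {Ω : Type*}

theorem finite_inPoll (R : AlgRun n m Ω) (P : Problem n m) (k : ℕ) (ω : Ω) :
    Finite {q : Center × ℕ // R.InPoll P k ω q.1 q.2} := by
  have : {q : Center × ℕ | R.InPoll P k ω q.1 q.2} ⊆
      ⋃ c : Center, (fun i => (c, i)) '' Set.Iio (R.num k c ω) := by
    rintro ⟨c, i⟩ hq
    exact Set.mem_iUnion.2 ⟨c, i, hq.2.1, rfl⟩
  exact ((Set.finite_iUnion fun c => (Set.finite_Iio _).image _).subset this).to_subtype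

theorem le_maxPoll {R : AlgRun n m Ω} {P : Problem n m} {k : ℕ} {ω : Ω} (g : Center → ℕ → ℝ)
    {c : Center} {i : ℕ} (h : R.InPoll P k ω c i) : g c i ≤ R.maxPoll P k ω g := by
  have := R.finite_inPoll P k ω
  exact le_ciSup (f := fun q : {q : Center × ℕ // R.InPoll P k ω q.1 q.2} => g q.1.1 q.1.2)
    (Set.finite_range _).bddAbove ⟨(c, i), h⟩

theorem maxPoll_nonneg {R : AlgRun n m Ω} {P : Problem n m} {k : ℕ} {ω : Ω}
    {g : Center → ℕ → ℝ} (hg : ∀ c i, 0 ≤ g c i) : 0 ≤ R.maxPoll P k ω g :=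
  Real.iSup_nonneg fun _ => hg _ _

/-- The information about an iteration that the convergence analysis uses: `h`-dominating and
improving iterations are merged. -/
theorem Step.cases {R : AlgRun n m Ω} {P : Problem n m} {A : Params n} {k : ℕ} {ω : Ω}
    (h : R.Step P A k ω) :
    (∃ c i, R.InPoll P k ω c i ∧
      (R.flag k ω = true → R.Fs k c i ω - R.F0 k .feas ω ≤ -(A.γ * A.ε * R.δ k ω ^ 2)) ∧
      R.inc (k + 1) .inf ω = R.inc k .inf ω ∧ R.inc (k + 1) .feas ω = R.trial k c i ω ∧
      R.δ (k + 1) ω = R.enlarged A k ω ∧ R.flag (k + 1) ω = true) ∨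
    (∃ i, R.Impr P A k ω i ∧
      R.inc (k + 1) .inf ω = R.trial k .inf i ω ∧ R.inc (k + 1) .feas ω = R.inc k .feas ω ∧
      R.δ (k + 1) ω = R.enlarged A k ω ∧ R.flag (k + 1) ω = R.flag k ω) ∨
    (R.inc (k + 1) .inf ω = R.inc k .inf ω ∧ R.inc (k + 1) .feas ω = R.inc k .feas ω ∧
      R.δ (k + 1) ω = A.τ * R.δ k ω ∧ R.flag (k + 1) ω = R.flag k ω) := by
  rcases h with ⟨c, i, h, h'⟩ | ⟨-, i, h, h'⟩ | ⟨-, -, i, h, -, h'⟩ | ⟨-, -, -, h'⟩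
  · exact Or.inl ⟨c, i, h.1, h.2.2, h'⟩
  · exact Or.inr (Or.inl ⟨i, h.1, h'⟩)
  · exact Or.inr (Or.inl ⟨i, h, h'⟩)
  · exact Or.inr (Or.inr h')

theorem eventually_xfeasT_eq (R : AlgRun n m Ω) (ω : Ω) :
    ∀ᶠ k in atTop, R.xfeasT k ω = R.inc k .feas ω := by
  filter_upwards [eventually_ge_atTop (R.T ω).toNat] with k hk
  rw [xfeasT, max_eq_left hk]

theorem GoodSubsequence.neBot {R : AlgRun n m Ω} {P : Problem n m} {ω : Ω} {K : Set ℕ} {x : Pt n}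
    (h : R.GoodSubsequence P ω K x) :
    (atTop ⊓ 𝓟 K).NeBot := by
  rw [← frequently_mem_iff_neBot]
  exact Nat.frequently_atTop_iff_infinite.2 h.infinite

theorem GoodSubsequence.mem_X {R : AlgRun n m Ω} {P : Problem n m}
    (hU : R.IteratesInCompact P) {ω : Ω} {K : Set ℕ} {x : Pt n}
    (h : R.GoodSubsequence P ω K x) : x ∈ P.X := by
  obtain ⟨U, hUc, hUX, hUi⟩ := hU
  have := h.neBot
  exact hUX (hUc.isClosed.mem_of_tendsto h.tendsto_x (Eventually.of_forall fun k => hUi _ _ _))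

/-! ### The potential -/

/-- The errors at the trial points are only controlled through their maximum; `fTrialErr` is the
maximal squared error of the estimates of `f` over the poll set. -/
noncomputable def fTrialErr (R : AlgRun n m Ω) (P : Problem n m) (k : ℕ) (ω : Ω) : ℝ :=
  R.maxPoll P k ω fun c i => |R.Fs k c i ω - P.f (R.trial k c i ω)| ^ 2

/-- The maximal error of the estimated constraint violation over the poll set. -/
noncomputable def hTrialErr (R : AlgRun n m Ω) (P : Problem n m) (k : ℕ) (ω : Ω) : ℝ :=
  R.maxPoll P k ω fun c i => |R.Hs k c i ω - P.h (R.trial k c i ω)|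

/-- An upper bound for the increase of the potential that estimation errors can cause in
iteration `k`. The errors `e` of the estimates of `f`, whose conditional second moments are known,
enter through `|e| ≤ σ ε δ² / 2 + e² / (2 σ ε δ²)`, where `σ` is a free parameter. -/
noncomputable def errorBound (R : AlgRun n m Ω) (P : Problem n m) (A : Params n) (ν σ : ℝ) (k : ℕ)
    (ω : Ω) : ℝ :=
  ν / A.ε * (σ * A.ε * R.δ k ω ^ 2 + ((2 * σ * A.ε * R.δ k ω ^ 2)⁻¹ * R.fTrialErr P k ω +
    (2 * σ * A.ε * R.δ k ω ^ 2)⁻¹ * |R.F0 k .feas ω - P.f (R.inc k .feas ω)| ^ 2)) +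
  ν / (m * A.ε) * (R.hTrialErr P k ω + |R.H0 k .inf ω - P.h (R.inc k .inf ω)|)

/-- The potential: a weighted sum of `f - κ` at the `ε`-feasible incumbent, of `h` at the
`ε`-infeasible incumbent and of the squared poll size. As long as there is no `ε`-feasible
incumbent, `f` is replaced by an upper bound `B` on the iterates, with a surplus that pays for the
iteration in which the first `ε`-feasible incumbent appears. -/
noncomputable def potential (R : AlgRun n m Ω) (P : Problem n m) (A : Params n) (ν κ B : ℝ)
    (k : ℕ) (ω : Ω) : ℝ :=
  (if R.flag k ω = true then ν / A.ε * (P.f (R.inc k .feas ω) - κ)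
    else ν / A.ε * (B - κ) + (A.τ⁻¹ * (A.τ ^ A.zhat)⁻¹) ^ 2) +
  ν / (m * A.ε) * P.h (R.inc k .inf ω) + (1 - ν) * R.δ k ω ^ 2

theorem potential_nonneg {R : AlgRun n m Ω} {P : Problem n m} {A : Params n}
    (hA : A.Valid P) {ν κ B : ℝ} (hν : ν ∈ Set.Ioo (0 : ℝ) 1) (hκ : ∀ k c ω, κ ≤ P.f (R.inc k c ω))
    (hB : ∀ k c ω, P.f (R.inc k c ω) ≤ B) (k : ℕ) (ω : Ω) : 0 ≤ R.potential P A ν κ B k ω := by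
  have hε := hA.ε_pos
  have hν0 := hν.1
  have hν1 : 0 < 1 - ν := by linarith [hν.2]
  have h1 : 0 ≤ P.f (R.inc k .feas ω) - κ := sub_nonneg.2 (hκ _ _ _)
  have h2 : 0 ≤ B - κ := sub_nonneg.2 ((hκ k .feas ω).trans (hB _ _ _))
  have h3 := P.h_nonneg (R.inc k .inf ω)
  rw [potential]
  split_ifs <;> positivity

/-! ### Runs generated by the algorithm -/

variable [MeasurableSpace Ω] {R : AlgRun n m Ω} {P : Problem n m} {A : Params n}

theorem IsGenerated.past_le (hR : R.IsGenerated P A) (k : ℕ) :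
    R.past k ≤ ‹MeasurableSpace Ω› := by
  refine iSup_le fun l => iSup_le fun _ => iSup_le fun c => sup_le (sup_le (sup_le ?_ ?_) ?_) ?_
  · exact (hR.measurable_F0 l c).comap_le
  · exact iSup_le fun i => (hR.measurable_Fs l c i).comap_le
  · exact iSup_le fun j => (hR.measurable_C0 l j c).comap_le
  · exact iSup_le fun j => iSup_le fun i => (hR.measurable_Cs l j c i).comap_le

theorem IsGenerated.size_bounds (hA : A.Valid P) (hR : R.IsGenerated P A) (k : ℕ) (ω : Ω) :
    A.τ ^ k * A.δ0 ≤ R.δ k ω ∧ R.δ k ω ≤ (A.τ ^ A.zhat)⁻¹ := by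
  have hτ := hA.τ_pos
  induction k with
  | zero => simpa [hR.δ_zero] using hA.δ0_le
  | succ k ih =>
    have hpos : 0 < R.δ k ω := (mul_pos (pow_pos hτ k) hA.δ0_pos).trans_le ih.1
    have hlow : A.τ ^ (k + 1) * A.δ0 ≤ A.τ * R.δ k ω := by
      rw [pow_succ', mul_assoc]; exact mul_le_mul_of_nonneg_left ih.1 hτ.le
    have hτδ : A.τ * R.δ k ω ≤ R.δ k ω := mul_le_of_le_one_left hpos.le hA.τ_lt.le
    have henl : R.δ k ω ≤ R.enlarged A k ω :=
      le_min (le_mul_of_one_le_left hpos.le ((one_le_inv₀ hτ).2 hA.τ_lt.le)) ih.2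
    rcases (hR.step k ω).cases with ⟨c, i, -, -, -, -, h, -⟩ | ⟨i, -, -, -, h, -⟩ | ⟨-, -, h, -⟩
    · rw [h]; exact ⟨hlow.trans (hτδ.trans henl), min_le_right _ _⟩
    · rw [h]; exact ⟨hlow.trans (hτδ.trans henl), min_le_right _ _⟩
    · rw [h]; exact ⟨hlow, hτδ.trans ih.2⟩

theorem IsGenerated.δ_pos (hA : A.Valid P) (hR : R.IsGenerated P A) (k : ℕ) (ω : Ω) :
    0 < R.δ k ω :=
  (mul_pos (pow_pos hA.τ_pos k) hA.δ0_pos).trans_le (hR.size_bounds hA k ω).1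

theorem IsGenerated.integrable_δ_pow (hA : A.Valid P) (hR : R.IsGenerated P A) (μ : Measure Ω)
    [IsFiniteMeasure μ] (k j : ℕ) : Integrable (fun ω => R.δ k ω ^ j) μ := by
  have hmeas : Measurable fun ω => R.δ k ω ^ j :=
    ((hR.adapted_δ k).mono (hR.past_le k) le_rfl).pow_const j
  refine Integrable.of_bound hmeas.aestronglyMeasurable ((A.τ ^ A.zhat)⁻¹ ^ j) ?_
  refine ae_of_all _ fun ω => ?_
  have hpos := hR.δ_pos hA k ω
  rw [Real.norm_of_nonneg (pow_nonneg hpos.le j)]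
  exact pow_le_pow_left₀ hpos.le (hR.size_bounds hA k ω).2 j

theorem IsGenerated.flag_of_feas_ne (hR : R.IsGenerated P A) {k : ℕ} {ω : Ω}
    (h : R.inc k .feas ω ≠ A.x0) : R.flag k ω = true := by
  induction k with
  | zero => exact absurd (hR.inc_zero _ ω) h
  | succ k ih =>
    rcases (hR.step k ω).cases with
      ⟨c, i, -, -, -, -, -, hf⟩ | ⟨i, -, -, hx, -, hf⟩ | ⟨-, hx, -, hf⟩
    · exact hf
    · rw [hf]; exact ih (hx ▸ h)
    · rw [hf]; exact ih (hx ▸ h)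

theorem IsGenerated.flag_mono (hR : R.IsGenerated P A) {k l : ℕ} (hkl : k ≤ l) {ω : Ω}
    (h : R.flag k ω = true) : R.flag l ω = true := by
  induction l, hkl using Nat.le_induction with
  | base => exact h
  | succ l _ ih =>
    rcases (hR.step l ω).cases with
      ⟨c, i, -, -, -, -, -, hf⟩ | ⟨i, -, -, -, -, hf⟩ | ⟨-, -, -, hf⟩
    · exact hf
    · rw [hf]; exact ih
    · rw [hf]; exact ih

theorem IsGenerated.eventually_flag (hR : R.IsGenerated P A) {ω : Ω} (hT : R.T ω < ⊤) :
    ∀ᶠ k in atTop, R.flag k ω = true := by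
  obtain ⟨k, hk⟩ := iInf_lt_iff.1 hT
  obtain ⟨⟨l, -, hne⟩, -⟩ := iInf_lt_iff.1 hk
  rw [hR.inc_zero] at hne
  filter_upwards [eventually_ge_atTop l] with j hj
  exact hR.flag_mono hj (hR.flag_of_feas_ne hne)

/-! ### Descent of the potential -/

theorem abs_le_young {s e : ℝ} (hs : 0 < s) : |e| ≤ s / 2 + (2 * s)⁻¹ * |e| ^ 2 := by
  have : s / 2 + (2 * s)⁻¹ * |e| ^ 2 - |e| = (2 * s)⁻¹ * (s - |e|) ^ 2 := by
    field_simp; ring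
  have h2 : 0 ≤ (2 * s)⁻¹ * (s - |e|) ^ 2 := by positivity
  linarith

/-- In a successful iteration the sufficient decrease `ν γ δ²` pays for the growth of the poll size
term of the potential and for the decrease `(1 - ν) (1 - τ²) δ²` of an unsuccessful iteration. -/
theorem size_growth_le (hA : A.Valid P) {ν : ℝ} (hν : ν ∈ Set.Ioo (0 : ℝ) 1)
    (hνγ : 2 * (A.τ⁻¹ ^ 2 - 1) / (A.γ - 2) ≤ ν / (1 - ν)) :
    (1 - ν) * (A.τ⁻¹ ^ 2 - 1) + (1 - ν) * (1 - A.τ ^ 2) ≤ ν * A.γ := by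
  have h1 : 0 < 1 - ν := by linarith [hν.2]
  have hγ : 0 < A.γ - 2 := by linarith [hA.γ_gt]
  rw [div_le_div_iff₀ hγ h1] at hνγ
  have hτ2 : 0 < A.τ ^ 2 := pow_pos hA.τ_pos 2
  have h2 : 1 - A.τ ^ 2 ≤ A.τ⁻¹ ^ 2 - 1 := by
    have : A.τ⁻¹ ^ 2 - 1 - (1 - A.τ ^ 2) = (A.τ⁻¹ - A.τ) ^ 2 := by
      have := hA.τ_pos.ne'
      field_simp
    nlinarith [sq_nonneg (A.τ⁻¹ - A.τ)]
  have h3 := mul_le_mul_of_nonneg_left h2 h1.le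
  nlinarith [hν.1]

/-- Pathwise descent: apart from estimation errors, every iteration, whatever its outcome, decreases
the potential by at least `(1 - ν) (1 - τ²) δ²`. -/
theorem potential_succ_le (hm : 0 < m) (hA : A.Valid P) (hR : R.IsGenerated P A) {ν σ κ B : ℝ}
    (hν : ν ∈ Set.Ioo (0 : ℝ) 1) (hνγ : 2 * (A.τ⁻¹ ^ 2 - 1) / (A.γ - 2) ≤ ν / (1 - ν))
    (hσ : 0 < σ) (hB : ∀ k c ω, P.f (R.inc k c ω) ≤ B) (k : ℕ) (ω : Ω) :
    R.potential P A ν κ B (k + 1) ω + (1 - ν) * (1 - A.τ ^ 2) * R.δ k ω ^ 2 ≤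
      R.potential P A ν κ B k ω + R.errorBound P A ν σ k ω := by
  have hδ := hR.δ_pos hA k ω
  have hε := hA.ε_pos
  have hτ := hA.τ_pos
  have hν0 := hν.1
  have hν1 : 0 < 1 - ν := by linarith [hν.2]
  have hm' : (0 : ℝ) < m := by exact_mod_cast hm
  set s : ℝ := σ * A.ε * R.δ k ω ^ 2 with hs_def
  have hs : 0 < s := by positivity
  have hs2 : 2 * σ * A.ε * R.δ k ω ^ 2 = 2 * s := by rw [hs_def]; ring
  have hf0 : 0 ≤ R.fTrialErr P k ω := maxPoll_nonneg fun _ _ => by positivity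
  have hh0 : 0 ≤ R.hTrialErr P k ω := maxPoll_nonneg fun _ _ => by positivity
  have hgrow := mul_le_mul_of_nonneg_right (size_growth_le hA hν hνγ) (sq_nonneg (R.δ k ω))
  -- The two parts of the error bound are nonnegative; each alternative uses only one of them.
  have hE1 : 0 ≤ ν / A.ε * (s + ((2 * s)⁻¹ * R.fTrialErr P k ω +
      (2 * s)⁻¹ * |R.F0 k .feas ω - P.f (R.inc k .feas ω)| ^ 2)) := by positivity
  have hE2 : 0 ≤ ν / (m * A.ε) *
      (R.hTrialErr P k ω + |R.H0 k .inf ω - P.h (R.inc k .inf ω)|) := by positivity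
  have henl : R.enlarged A k ω ^ 2 ≤ A.τ⁻¹ ^ 2 * R.δ k ω ^ 2 := by
    rw [← mul_pow]
    exact pow_le_pow_left₀ (le_min (by positivity) (by positivity)) (min_le_left _ _) 2
  have henl' := mul_le_mul_of_nonneg_left henl hν1.le
  simp only [potential, errorBound, hs2, ← hs_def]
  rcases (hR.step k ω).cases with
    ⟨c, i, hpoll, hdec, hxi, hxf, hδ', hfl⟩ | ⟨i, hI, hxi, hxf, hδ', hfl⟩ | ⟨hxi, hxf, hδ', hfl⟩
  · rw [hxi, hδ', if_pos hfl]
    by_cases hflag : R.flag k ω = true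
    · rw [if_pos hflag, hxf]
      have hdec := hdec hflag
      have e1 := abs_le_young (e := R.Fs k c i ω - P.f (R.trial k c i ω)) hs
      have e2 := abs_le_young (e := R.F0 k .feas ω - P.f (R.inc k .feas ω)) hs
      have e3 : |R.Fs k c i ω - P.f (R.trial k c i ω)| ^ 2 ≤ R.fTrialErr P k ω :=
        le_maxPoll (fun c i => |R.Fs k c i ω - P.f (R.trial k c i ω)| ^ 2) hpoll
      have e4 := mul_le_mul_of_nonneg_left e3 (show 0 ≤ (2 * s)⁻¹ by positivity)
      have e5 := neg_abs_le (R.Fs k c i ω - P.f (R.trial k c i ω))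
      have e6 := le_abs_self (R.F0 k .feas ω - P.f (R.inc k .feas ω))
      have e7 : P.f (R.trial k c i ω) - P.f (R.inc k .feas ω) + A.γ * A.ε * R.δ k ω ^ 2 ≤
          s + ((2 * s)⁻¹ * R.fTrialErr P k ω +
            (2 * s)⁻¹ * |R.F0 k .feas ω - P.f (R.inc k .feas ω)| ^ 2) := by linarith
      have e8 := mul_le_mul_of_nonneg_left e7 (show 0 ≤ ν / A.ε by positivity)
      have e9 : ν / A.ε * (P.f (R.trial k c i ω) - P.f (R.inc k .feas ω) +
          A.γ * A.ε * R.δ k ω ^ 2) = ν / A.ε * (P.f (R.trial k c i ω) - κ) -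
          ν / A.ε * (P.f (R.inc k .feas ω) - κ) + ν * A.γ * R.δ k ω ^ 2 := by
        field_simp; ring
      linarith
    -- The first `ε`-feasible incumbent appears: `f ≤ B`, and the surplus covers the poll size.
    · rw [if_neg hflag]
      have e1 := mul_le_mul_of_nonneg_left (sub_le_sub_right (hB (k + 1) .feas ω) κ)
        (show 0 ≤ ν / A.ε by positivity)
      have e2 : A.τ⁻¹ ^ 2 * R.δ k ω ^ 2 ≤ (A.τ⁻¹ * (A.τ ^ A.zhat)⁻¹) ^ 2 := by
        rw [mul_pow]
        exact mul_le_mul_of_nonneg_left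
          (pow_le_pow_left₀ hδ.le (hR.size_bounds hA k ω).2 2) (by positivity)
      have e3 : 0 ≤ ν * (A.τ⁻¹ ^ 2 * R.δ k ω ^ 2) := by positivity
      have e4 : 0 ≤ (1 - ν) * (A.τ ^ 2 * R.δ k ω ^ 2) := by positivity
      linarith
  · rw [hxi, hxf, hδ', hfl]
    have hdec := hI.2
    have e3 : |R.Hs k .inf i ω - P.h (R.trial k .inf i ω)| ≤ R.hTrialErr P k ω :=
      le_maxPoll (fun c i => |R.Hs k c i ω - P.h (R.trial k c i ω)|) hI.1
    have e5 := neg_abs_le (R.Hs k .inf i ω - P.h (R.trial k .inf i ω))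
    have e6 := le_abs_self (R.H0 k .inf ω - P.h (R.inc k .inf ω))
    have e7 : P.h (R.trial k .inf i ω) - P.h (R.inc k .inf ω) +
        A.γ * m * A.ε * R.δ k ω ^ 2 ≤
        R.hTrialErr P k ω + |R.H0 k .inf ω - P.h (R.inc k .inf ω)| := by linarith
    have e8 := mul_le_mul_of_nonneg_left e7 (show 0 ≤ ν / (m * A.ε) by positivity)
    have e9 : ν / (m * A.ε) * (P.h (R.trial k .inf i ω) - P.h (R.inc k .inf ω) +
        A.γ * m * A.ε * R.δ k ω ^ 2) = ν / (m * A.ε) * P.h (R.trial k .inf i ω) -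
        ν / (m * A.ε) * P.h (R.inc k .inf ω) + ν * A.γ * R.δ k ω ^ 2 := by
      field_simp
    linarith
  · rw [hxi, hxf, hδ', hfl]
    linarith

/-! ### Summability of the squared poll sizes -/

/-- The mean of a squared error, weighted as in `errorBound`. The parameter `σ = √(1 - β)` balances
the two terms there, since the conditional second moment is at most `ε² (1 - β) δ⁴`. -/
theorem integral_weighted_sq_le (hA : A.Valid P) (hR : R.IsGenerated P A) {μ : Measure Ω}
    [IsFiniteMeasure μ] {β : ℝ} (hβ : β ∈ Set.Ioo (0 : ℝ) 1) {k : ℕ} {Y : Ω → ℝ}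
    (hY : R.CondMeanLe μ k Y fun ω => A.ε ^ 2 * (1 - √β) * R.δ k ω ^ 4) :
    Integrable (fun ω => (2 * √(1 - β) * A.ε * R.δ k ω ^ 2)⁻¹ * Y ω) μ ∧
    ∫ ω, (2 * √(1 - β) * A.ε * R.δ k ω ^ 2)⁻¹ * Y ω ∂μ ≤
      √(1 - β) * A.ε / 2 * ∫ ω, R.δ k ω ^ 2 ∂μ := by
  have hε := hA.ε_pos
  have hσ : 0 < √(1 - β) := Real.sqrt_pos.2 (by linarith [hβ.2])
  have hδ := hR.δ_pos hA k
  have hlow : 0 < A.τ ^ k * A.δ0 := mul_pos (pow_pos hA.τ_pos k) hA.δ0_pos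
  have hmeas : Measurable[R.past k] fun ω => (2 * √(1 - β) * A.ε * R.δ k ω ^ 2)⁻¹ :=
    (((hR.adapted_δ k).pow_const 2).const_mul _).inv
  have hprod : ∀ ω, (2 * √(1 - β) * A.ε * R.δ k ω ^ 2)⁻¹ *
      (A.ε ^ 2 * (1 - √β) * R.δ k ω ^ 4) =
      A.ε * (1 - √β) / (2 * √(1 - β)) * R.δ k ω ^ 2 := fun ω => by
    have := (hδ ω).ne'
    field_simp
  have hint := hR.integrable_δ_pow hA μ k 2
  obtain ⟨h1, h2⟩ := integral_mul_le_of_condExp_le (hR.past_le k) hmeas.stronglyMeasurable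
    (fun ω => by have := hδ ω; positivity)
    (C := (2 * √(1 - β) * A.ε * (A.τ ^ k * A.δ0) ^ 2)⁻¹)
    (fun ω => inv_anti₀ (by positivity) (mul_le_mul_of_nonneg_left
      (pow_le_pow_left₀ hlow.le (hR.size_bounds hA k ω).1 2) (by positivity)))
    hY.1 hY.2 (by simp only [hprod]; exact hint.const_mul _)
  refine ⟨h1, h2.trans ?_⟩
  simp only [hprod]
  rw [integral_const_mul]
  refine mul_le_mul_of_nonneg_right ?_ (integral_nonneg fun ω => sq_nonneg _)
  -- `1 - √β ≤ 1 - β`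
  have hβ1 : 1 - √β ≤ √(1 - β) ^ 2 := by
    rw [Real.sq_sqrt (by linarith [hβ.2])]
    have : β ≤ √β := Real.le_sqrt_of_sq_le (by nlinarith [hβ.1, hβ.2])
    linarith
  rw [div_le_div_iff₀ (by positivity) (by positivity)]
  nlinarith

theorem CondMeanLe.integral_le (hR : R.IsGenerated P A) {μ : Measure Ω} [IsFiniteMeasure μ]
    {k : ℕ} {Y B : Ω → ℝ} (hY : R.CondMeanLe μ k Y B) (hB : Integrable B μ) :
    ∫ ω, Y ω ∂μ ≤ ∫ ω, B ω ∂μ := by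
  rw [← integral_condExp (hR.past_le k)]
  exact integral_mono_ae integrable_condExp hB hY.2

theorem integral_errorBound_le (hm : 0 < m) (hA : A.Valid P) (hR : R.IsGenerated P A)
    {μ : Measure Ω} [IsFiniteMeasure μ] {α β ν : ℝ} (hβ : β ∈ Set.Ioo (0 : ℝ) 1)
    (hν : ν ∈ Set.Ioo (0 : ℝ) 1) (hest : R.EstimatesOK μ P A α β) (k : ℕ) :
    Integrable (R.errorBound P A ν (√(1 - β)) k) μ ∧
    ∫ ω, R.errorBound P A ν (√(1 - β)) k ω ∂μ ≤
      2 * ν * (√(1 - α) + √(1 - β)) * ∫ ω, R.δ k ω ^ 2 ∂μ := by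
  have hε := hA.ε_pos
  have hm' : (0 : ℝ) < m := by exact_mod_cast hm
  have hν0 := hν.1
  have hint := hR.integrable_δ_pow hA μ k 2
  obtain ⟨i1, b1⟩ : Integrable
        (fun ω => (2 * √(1 - β) * A.ε * R.δ k ω ^ 2)⁻¹ * R.fTrialErr P k ω) μ ∧
      ∫ ω, (2 * √(1 - β) * A.ε * R.δ k ω ^ 2)⁻¹ * R.fTrialErr P k ω ∂μ ≤
        √(1 - β) * A.ε / 2 * ∫ ω, R.δ k ω ^ 2 ∂μ :=
    integral_weighted_sq_le hA hR hβ (hest.f_var_s k)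
  obtain ⟨i2, b2⟩ := integral_weighted_sq_le hA hR hβ (hest.f_var_0 k .feas)
  have i3 : Integrable (fun ω => R.hTrialErr P k ω) μ := (hest.h_mean_s k).1
  have i4 := (hest.h_mean_0 k .inf).1
  have b3 := (hest.h_mean_s k).integral_le hR (hint.const_mul _)
  have b4 := (hest.h_mean_0 k .inf).integral_le hR (hint.const_mul _)
  rw [integral_const_mul] at b3 b4
  have i0 := hint.const_mul (√(1 - β) * A.ε)
  have i12 := i1.fun_add i2
  have i34 := (i3.fun_add i4).const_mul (ν / (m * A.ε))
  have i02 := (i0.fun_add i12).const_mul (ν / A.ε)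
  refine ⟨i02.add i34, ?_⟩
  have heq : ∫ ω, R.errorBound P A ν (√(1 - β)) k ω ∂μ =
      ν / A.ε * (√(1 - β) * A.ε * ∫ ω, R.δ k ω ^ 2 ∂μ +
        (∫ ω, (2 * √(1 - β) * A.ε * R.δ k ω ^ 2)⁻¹ * R.fTrialErr P k ω ∂μ +
        ∫ ω, (2 * √(1 - β) * A.ε * R.δ k ω ^ 2)⁻¹ *
          |R.F0 k .feas ω - P.f (R.inc k .feas ω)| ^ 2 ∂μ)) +
      ν / (m * A.ε) * (∫ ω, R.hTrialErr P k ω ∂μ +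
        ∫ ω, |R.H0 k .inf ω - P.h (R.inc k .inf ω)| ∂μ) := by
    unfold errorBound
    rw [integral_add i02 i34,
      integral_const_mul, integral_const_mul, integral_add i0 i12,
      integral_add i1 i2, integral_add i3 i4, integral_const_mul]
  rw [heq]
  calc _ ≤ ν / A.ε * (√(1 - β) * A.ε * ∫ ω, R.δ k ω ^ 2 ∂μ +
        (√(1 - β) * A.ε / 2 * ∫ ω, R.δ k ω ^ 2 ∂μ +
          √(1 - β) * A.ε / 2 * ∫ ω, R.δ k ω ^ 2 ∂μ)) +
      ν / (m * A.ε) * (m * A.ε * √(1 - α) * ∫ ω, R.δ k ω ^ 2 ∂μ +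
        m * A.ε * √(1 - α) * ∫ ω, R.δ k ω ^ 2 ∂μ) := by
        gcongr
        exact b3
    _ = _ := by field_simp; ring

theorem sum_integral_sq_δ_le (hm : 0 < m) (hP : P.Regular) (hA : A.Valid P)
    (hR : R.IsGenerated P A) (hU : R.IteratesInCompact P) {μ : Measure Ω}
    [IsProbabilityMeasure μ] {α β ν : ℝ} (hβ : β ∈ Set.Ioo (0 : ℝ) 1)
    (hν : ν ∈ Set.Ioo (0 : ℝ) 1)
    (hνγ : 2 * (A.τ⁻¹ ^ 2 - 1) / (A.γ - 2) ≤ ν / (1 - ν))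
    (hαβν : 4 * ν / ((1 - ν) * (1 - A.τ ^ 2)) * (√(1 - α) + 2 * √(1 - β)) ≤ α * β)
    (hαβ : α * β < 1) (hest : R.EstimatesOK μ P A α β) :
    ∃ C : ℝ, ∀ N, ∑ k ∈ Finset.range N, ∫ ω, R.δ k ω ^ 2 ∂μ ≤ C := by
  obtain ⟨U, hUc, hUX, hUi⟩ := hU
  obtain ⟨κ, hκ⟩ := hP.bounded_f
  obtain ⟨B, hB⟩ := (hUc.image_of_continuousOn (hP.lipschitz_f.continuousOn.mono hUX)).bddAbove
  have hκ' : ∀ k c ω, κ ≤ P.f (R.inc k c ω) := fun k c ω => hκ _ (hUX (hUi k c ω))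
  have hB' : ∀ k c ω, P.f (R.inc k c ω) ≤ B := fun k c ω => hB ⟨_, hUi k c ω, rfl⟩
  have hσ : 0 < √(1 - β) := Real.sqrt_pos.2 (by linarith [hβ.2])
  have hν1 : 0 < 1 - ν := by linarith [hν.2]
  have hq : 0 < (1 - ν) * (1 - A.τ ^ 2) :=
    mul_pos hν1 (by nlinarith [hA.τ_pos, hA.τ_lt])
  set q := (1 - ν) * (1 - A.τ ^ 2) with hq_def
  -- The mean error is at most half of the guaranteed decrease.
  have hhalf : 2 * ν * (√(1 - α) + √(1 - β)) ≤ q / 2 := by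
    have h1 : 4 * ν * (√(1 - α) + 2 * √(1 - β)) ≤ α * β * q := by
      rw [div_mul_eq_mul_div, div_le_iff₀ hq] at hαβν
      exact hαβν
    have h2 : α * β * q ≤ q := mul_le_of_le_one_left hq.le hαβ.le
    nlinarith [mul_pos hν.1 hσ]
  set C0 : ℝ := ν / A.ε * (B - κ) + (A.τ⁻¹ * (A.τ ^ A.zhat)⁻¹) ^ 2 +
    ν / (m * A.ε) * P.h A.x0 + (1 - ν) * A.δ0 ^ 2 with hC0
  have hinit : ∀ ω, R.potential P A ν κ B 0 ω = C0 := fun ω => by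
    simp [potential, hR.flag_zero, hR.inc_zero, hR.δ_zero, hC0]
  have htel : ∀ N ω, R.potential P A ν κ B N ω + ∑ k ∈ Finset.range N, q * R.δ k ω ^ 2 ≤
      C0 + ∑ k ∈ Finset.range N, R.errorBound P A ν (√(1 - β)) k ω := by
    intro N ω
    induction N with
    | zero => simp [hinit]
    | succ N ih =>
      have := potential_succ_le (κ := κ) hm hA hR hν hνγ hσ hB' N ω
      rw [Finset.sum_range_succ, Finset.sum_range_succ]
      linarith
  have herr := integral_errorBound_le (ν := ν) hm hA hR hβ hν hest
  refine ⟨2 * C0 / q, fun N => ?_⟩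
  have hδint : ∀ k, Integrable (fun ω => q * R.δ k ω ^ 2) μ :=
    fun k => (hR.integrable_δ_pow hA μ k 2).const_mul q
  have hmono : ∫ ω, ∑ k ∈ Finset.range N, q * R.δ k ω ^ 2 ∂μ ≤
      ∫ ω, (C0 + ∑ k ∈ Finset.range N, R.errorBound P A ν (√(1 - β)) k ω) ∂μ := by
    refine integral_mono (integrable_finsetSum _ fun k _ => hδint k)
      ((integrable_const _).add (integrable_finsetSum _ fun k _ => (herr k).1)) fun ω => ?_
    have := htel N ω
    have := potential_nonneg hA hν hκ' hB' N ω
    simp only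
    linarith
  rw [integral_finsetSum _ fun k _ => hδint k,
    integral_add (integrable_const _) (integrable_finsetSum _ fun k _ => (herr k).1),
    integral_finsetSum _ fun k _ => (herr k).1] at hmono
  simp only [integral_const_mul, integral_const, probReal_univ, one_smul, ← Finset.mul_sum]
    at hmono
  have hsum : ∑ k ∈ Finset.range N, ∫ ω, R.errorBound P A ν (√(1 - β)) k ω ∂μ ≤
      q / 2 * ∑ k ∈ Finset.range N, ∫ ω, R.δ k ω ^ 2 ∂μ := by
    rw [Finset.mul_sum]
    refine Finset.sum_le_sum fun k _ => (herr k).2.trans ?_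
    exact mul_le_mul_of_nonneg_right hhalf (integral_nonneg fun ω => sq_nonneg _)
  rw [le_div_iff₀ hq]
  linarith

/-! ### Feasibility and stationarity of the refined point -/

theorem GoodSubsequence.mem_feasible {Ω : Type*} {R : AlgRun n m Ω} (hP : P.Regular)
    (hU : R.IteratesInCompact P) {ω : Ω} {K : Set ℕ} {x : Pt n} (h : R.GoodSubsequence P ω K x)
    (herr : Tendsto (fun k => |R.H0 k .feas ω - P.h (R.inc k .feas ω)|) atTop (𝓝 0)) :
    x ∈ P.feasible := by
  have hx := h.mem_X hU
  have := h.neBot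
  refine Problem.mem_feasible_of_h_eq_zero hx ?_
  have hX : ∀ k, R.xfeasT k ω ∈ P.X := fun k => by
    obtain ⟨U, -, hUX, hUi⟩ := hU
    exact hUX (hUi _ _ _)
  have h1 : Tendsto (fun k => P.h (R.xfeasT k ω)) (atTop ⊓ 𝓟 K) (𝓝 (P.h x)) :=
    (hP.lipschitz_h.continuousOn x hx).tendsto.comp
      (tendsto_nhdsWithin_iff.2 ⟨h.tendsto_x, Eventually.of_forall hX⟩)
  have h2 : Tendsto (fun k => R.H0 k .feas ω - P.h (R.inc k .feas ω)) (atTop ⊓ 𝓟 K) (𝓝 0) :=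
    ((tendsto_zero_iff_abs_tendsto_zero _).2 herr).mono_left inf_le_left
  have h3 : Tendsto (fun k => P.h (R.xfeasT k ω)) (atTop ⊓ 𝓟 K) (𝓝 0) := by
    refine (by simpa using h.tendsto_H0.sub h2 :
      Tendsto (fun k => P.h (R.inc k .feas ω)) (atTop ⊓ 𝓟 K) (𝓝 0)).congr' ?_
    filter_upwards [(R.eventually_xfeasT_eq ω).filter_mono inf_le_left] with k hk
    rw [hk]
  exact tendsto_nhds_unique h1 h3

/-- A vector `v` of the hypertangent cone keeps nearby points of the set inside it, also for
directions and step lengths that are only asymptotically `v` and `0`. -/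
theorem eventually_add_smul_mem {n : ℕ} {ι : Type*} {l : Filter ι} {O : Set (Pt n)} {x v : Pt n}
    (hv : v ∈ hypertangentCone O x) {y w : ι → Pt n} {t : ι → ℝ} (hyO : ∀ᶠ i in l, y i ∈ O)
    (hy : Tendsto y l (𝓝 x)) (hw : Tendsto w l (𝓝 v)) (ht : Tendsto t l (𝓝[>] 0)) :
    ∀ᶠ i in l, y i + t i • w i ∈ O := by
  obtain ⟨r, hr, h⟩ := hv
  filter_upwards [hyO, hy (Metric.ball_mem_nhds x hr), hw (Metric.ball_mem_nhds v hr),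
    ht (Ioo_mem_nhdsGT hr)] with i h1 h2 h3 h4
  exact h _ ⟨h1, h2⟩ _ h3 _ h4.1 h4.2

/-- Nearly nonnegative difference quotients along directions tending to `v` make the Clarke
derivative of a locally Lipschitz function in the direction `v` nonnegative. -/
theorem clarkeDeriv_nonneg {n : ℕ} {ι : Type*} {l : Filter ι} [l.NeBot] {X : Set (Pt n)}
    {f : Pt n → ℝ} {x v : Pt n} (hx : x ∈ X) (hf : LocallyLipschitzOn X f) {y w : ι → Pt n}
    {t : ι → ℝ} (hy : Tendsto y l (𝓝 x)) (hw : Tendsto w l (𝓝 v)) (ht : Tendsto t l (𝓝[>] 0))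
    (hyX : ∀ᶠ i in l, y i ∈ X) (hvX : ∀ᶠ i in l, y i + t i • v ∈ X)
    (hwX : ∀ᶠ i in l, y i + t i • w i ∈ X)
    (hquot : ∀ η > 0, ∀ᶠ i in l, -(η * t i) ≤ f (y i + t i • w i) - f (y i)) :
    0 ≤ clarkeDeriv X f x v := by
  obtain ⟨L, s, hs, hL⟩ := hf hx
  have ht0 : Tendsto t l (𝓝 0) := ht.mono_right nhdsWithin_le_nhds
  have hmem : ∀ {u : ι → Pt n} {u0 : Pt n}, Tendsto u l (𝓝 u0) →
      (∀ᶠ i in l, y i + t i • u i ∈ X) → ∀ᶠ i in l, y i + t i • u i ∈ s := by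
    intro u u0 hu huX
    have : Tendsto (fun i => y i + t i • u i) l (𝓝 x) := by
      simpa using hy.add (ht0.smul hu)
    exact (tendsto_nhdsWithin_iff.2 ⟨this, huX⟩) hs
  have hpath : Tendsto (fun i => (y i, t i)) l
      ((𝓝 x ×ˢ 𝓝[>] (0 : ℝ)) ⊓ 𝓟 {q | q.1 ∈ X ∧ q.1 + q.2 • v ∈ X}) :=
    tendsto_inf.2 ⟨hy.prodMk ht, tendsto_principal.2 (hyX.and hvX)⟩
  have key : ∀ η : ℝ, 0 < η → ((-η : ℝ) : EReal) ≤ clarkeDeriv X f x v := by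
    intro η hη
    refine le_limsup_of_frequently_le' (hpath.frequently (Eventually.frequently ?_))
    have hLw : ∀ᶠ i in l, L * ‖w i - v‖ < η / 2 := by
      have : Tendsto (fun i => (L : ℝ) * ‖w i - v‖) l (𝓝 0) := by
        simpa using ((hw.sub_const v).norm.const_mul (L : ℝ))
      exact this.eventually_lt_const (by positivity)
    filter_upwards [hmem hw hwX, hmem tendsto_const_nhds hvX, hLw, hquot (η / 2) (by positivity),
      ht self_mem_nhdsWithin] with i h1 h2 h3 h4 h5
    have h5 : 0 < t i := h5
    rw [EReal.coe_le_coe_iff, le_div_iff₀ h5]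
    have h6 := hL.dist_le_mul _ h1 _ h2
    rw [Real.dist_eq, dist_eq_norm, add_sub_add_left_eq_sub, ← smul_sub, norm_smul,
      Real.norm_of_nonneg h5.le] at h6
    have h7 := (le_abs_self _).trans h6
    have h8 := mul_le_mul_of_nonneg_right h3.le h5.le
    linarith
  refine le_of_forall_lt fun b hb => ?_
  obtain ⟨z, hbz, hz⟩ := EReal.lt_iff_exists_real_btwn.1 hb
  have := key (-z) (by simpa using hz)
  rw [neg_neg] at this
  exact hbz.trans_le this

theorem stationary_of_goodSubsequence (hP : P.Regular) (hA : A.Valid P) (hR : R.IsGenerated P A)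
    (hU : R.IteratesInCompact P) (hd : R.DirectionsBoundedBelow) {ω : Ω} (hT : R.T ω < ⊤)
    {K : Set ℕ} {x : Pt n} (hK : R.GoodSubsequence P ω K x)
    (hδ0 : Tendsto (fun k => R.δ k ω) atTop (𝓝 0)) : R.Stationary P ω K x := by
  intro v hvD ⟨L, hLK, hL, d, hdL, hdv⟩ hcase
  have hLF : atTop ⊓ 𝓟 L ≤ atTop ⊓ 𝓟 K := inf_le_inf_left _ (principal_mono.2 hLK)
  have hne : (atTop ⊓ 𝓟 L).NeBot := by
    rw [← frequently_mem_iff_neBot]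
    exact Nat.frequently_atTop_iff_infinite.2 hL
  obtain ⟨dmin, hdmin, hdir⟩ := hd
  have hx := hK.mem_X hU
  have hX : ∀ k, R.xfeasT k ω ∈ P.X := fun k => by
    obtain ⟨U, -, hUX, hUi⟩ := hU
    exact hUX (hUi _ _ _)
  have hδ := fun k => hR.δ_pos hA k ω
  have hmemL : ∀ᶠ k in atTop ⊓ 𝓟 L, k ∈ L := mem_inf_of_right (mem_principal_self L)
  have hflag : ∀ᶠ k in atTop ⊓ 𝓟 L, R.flag k ω = true :=
    (hR.eventually_flag hT).filter_mono inf_le_left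
  have hδm : ∀ k, 0 < R.δm k ω := fun k => lt_min (hδ k) (pow_pos (hδ k) 2)
  have hdpos : ∀ᶠ k in atTop ⊓ 𝓟 L, 0 < ‖d k‖ := by
    filter_upwards [hmemL, hflag] with k hk hf
    exact norm_pos_iff.2 ((hR.frame k ω .feas hf).ne_zero _ (hdL k hk))
  -- The step `δm d` is written as a step of length `t = δm ‖d‖` in the direction `d / ‖d‖`.
  set t : ℕ → ℝ := fun k => R.δm k ω * ‖d k‖ with ht_def
  have hstep : ∀ᶠ k in atTop ⊓ 𝓟 L, t k • (‖d k‖⁻¹ • d k) = R.δm k ω • d k := by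
    filter_upwards [hdpos] with k hk
    rw [ht_def, smul_smul, mul_assoc, mul_inv_cancel₀ hk.ne', mul_one]
  have ht : Tendsto t (atTop ⊓ 𝓟 L) (𝓝[>] 0) := by
    refine tendsto_nhdsWithin_iff.2 ⟨?_, ?_⟩
    · have hup : Tendsto (fun k => R.δ k ω * A.b) (atTop ⊓ 𝓟 L) (𝓝 0) := by
        simpa using (hδ0.mono_left inf_le_left).mul_const A.b
      refine squeeze_zero' (Eventually.of_forall fun k => ?_) ?_ hup
      · exact mul_nonneg (hδm k).le (norm_nonneg _)
      · filter_upwards [hmemL, hflag] with k hk hf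
        exact (hR.frame k ω .feas hf).norm_le _ (hdL k hk)
    · filter_upwards [hdpos] with k hk
      exact mul_pos (hδm k) hk
  have hxL := hK.tendsto_x.mono_left hLF
  obtain ⟨hvX, hwX⟩ : (∀ᶠ k in atTop ⊓ 𝓟 L, R.xfeasT k ω + t k • v ∈ P.X) ∧
      ∀ᶠ k in atTop ⊓ 𝓟 L, R.xfeasT k ω + t k • (‖d k‖⁻¹ • d k) ∈ P.X := by
    rcases hcase with hvX | hfeas
    · have hX' := Eventually.of_forall (f := atTop ⊓ 𝓟 L) hX
      exact ⟨eventually_add_smul_mem hvX hX' hxL tendsto_const_nhds ht,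
        eventually_add_smul_mem hvX hX' hxL hdv ht⟩
    · have hfeas' := hfeas.filter_mono hLF
      exact ⟨(eventually_add_smul_mem hvD hfeas' hxL tendsto_const_nhds ht).mono fun _ h => h.1,
        (eventually_add_smul_mem hvD hfeas' hxL hdv ht).mono fun _ h => h.1⟩
  refine clarkeDeriv_nonneg hx hP.lipschitz_f hxL hdv ht (Eventually.of_forall hX) hvX hwX ?_
  intro η hη
  filter_upwards [(hK.limsup_Psi (η * dmin) (by positivity)).filter_mono hLF, hmemL, hflag, hstep,
    hwX, (hδ0.mono_left inf_le_left).eventually_lt_const one_pos] with k h1 h2 h3 h4 h5 h6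
  rw [h4] at h5 ⊢
  have h7 := h1 _ (hdL k h2) h5
  rw [Psi, div_le_iff₀ (hδ k)] at h7
  -- For `δ < 1` the mesh size is `δ²`, so that `t = δ (δ ‖d‖) ≥ δ dmin`.
  have h8 : R.δm k ω = R.δ k ω ^ 2 := min_eq_right (by nlinarith [hδ k])
  have h9 : dmin * R.δ k ω ≤ t k := by
    have := mul_le_mul_of_nonneg_left (hdir k ω .feas h3 _ (hdL k h2)) (hδ k).le
    simp only [ht_def, h8]
    linarith
  have h10 := mul_le_mul_of_nonneg_left h9 hη.le
  linarith

end AlgRun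

end StoMADS

theorem mainTheorem3 {n m : ℕ} (hm : 0 < m) {Ω : Type*} [MeasurableSpace Ω]
    (μ : MeasureTheory.Measure Ω) [MeasureTheory.IsProbabilityMeasure μ]
    (P : StoMADS.Problem n m) (hP : P.Regular)
    (A : StoMADS.Params n) (hA : A.Valid P)
    (R : StoMADS.AlgRun n m Ω) (hR : R.IsGenerated P A)
    (hU : R.IteratesInCompact P) (hd : R.DirectionsBoundedBelow)
    (α β ν : ℝ) (hα : α ∈ Set.Ioo (0 : ℝ) 1) (hβ : β ∈ Set.Ioo (0 : ℝ) 1)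
    (hν : ν ∈ Set.Ioo (0 : ℝ) 1)
    (hνγ : 2 * (A.τ⁻¹ ^ 2 - 1) / (A.γ - 2) ≤ ν / (1 - ν))
    (hαβν : 4 * ν / ((1 - ν) * (1 - A.τ ^ 2)) * (√(1 - α) + 2 * √(1 - β)) ≤ α * β)
    (hαβ : α * β ∈ Set.Ioo (1 / 2 : ℝ) 1)
    (hest : R.EstimatesOK μ P A α β)
    (hT : ∀ᵐ ω ∂μ, R.T ω < ⊤)
    (K : Ω → Set ℕ) (xhat : Ω → StoMADS.Pt n)
    (hK : ∀ᵐ ω ∂μ, R.GoodSubsequence P ω (K ω) (xhat ω)) :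
    (∀ᵐ ω ∂μ, xhat ω ∈ P.feasible) ∧
    (∀ ω, R.T ω < ⊤ → R.GoodSubsequence P ω (K ω) (xhat ω) →
      Filter.Tendsto (fun k => R.δ k ω) Filter.atTop (nhds 0) → xhat ω ∈ P.feasible →
      R.Stationary P ω (K ω) (xhat ω)) ∧
    (∀ᵐ ω ∂μ, xhat ω ∈ P.feasible ∧ R.Stationary P ω (K ω) (xhat ω)) := by
  obtain ⟨C, hC⟩ := StoMADS.AlgRun.sum_integral_sq_δ_le hm hP hA hR hU hβ hν hνγ hαβν hαβ.2 hest
  have hint := fun k => hR.integrable_δ_pow hA μ k 2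
  have hδ : ∀ᵐ ω ∂μ, Tendsto (fun k => R.δ k ω) atTop (𝓝 0) := by
    filter_upwards [StoMADS.ae_tendsto_zero_of_sum_integral_le
      (fun k ω => sq_nonneg (R.δ k ω)) hint hC] with ω h
    simpa [Real.sqrt_sq (hR.δ_pos hA _ ω).le] using h.sqrt
  have herr : ∀ᵐ ω ∂μ,
      Tendsto (fun k => |R.H0 k .feas ω - P.h (R.inc k .feas ω)|) atTop (𝓝 0) := by
    refine StoMADS.ae_tendsto_zero_of_sum_integral_le (C := m * A.ε * √(1 - α) * C)
      (fun k ω => abs_nonneg _) (fun k => (hest.h_mean_0 k .feas).1) fun N => ?_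
    have hε := hA.ε_pos
    calc _ ≤ ∑ k ∈ Finset.range N, m * A.ε * √(1 - α) * ∫ ω, R.δ k ω ^ 2 ∂μ := by
          refine Finset.sum_le_sum fun k _ => ?_
          rw [← integral_const_mul]
          exact (hest.h_mean_0 k .feas).integral_le hR ((hint k).const_mul _)
      _ ≤ _ := by
          rw [← Finset.mul_sum]
          exact mul_le_mul_of_nonneg_left (hC N) (by positivity)
  have hfeas : ∀ᵐ ω ∂μ, xhat ω ∈ P.feasible := by
    filter_upwards [hK, herr] with ω h1 h2
    exact h1.mem_feasible hP hU h2
  refine ⟨hfeas, fun ω h1 h2 h3 _ =>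
    StoMADS.AlgRun.stationary_of_goodSubsequence hP hA hR hU hd h1 h2 h3, ?_⟩
  filter_upwards [hfeas, hT, hK, hδ] with ω h1 h2 h3 h4
  exact ⟨h1, StoMADS.AlgRun.stationary_of_goodSubsequence hP hA hR hU hd h2 h3 h4⟩
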